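/- Conventions. For $i\in\mathbb N$ let $W_i$ be the recursively enumerable (RE) set with index $i$, i.e. the domain of the $i$-th partial recursive function. A disjoint pair $(A,B)$ of RE sets is \emph{effectively inseparable} (EI) if there is a recursive function $h(x,y)$ such that for all $i,j$: if $A\subseteq W_i$, $B\subseteq W_j$ and $W_i\cap W_j=\emptyset$, then $h(i,j)\notin W_i\cup W_j$. Fix a finite first-order signature with a constant symbol $\mathbf 0$ and a unary function symbol $\mathbf S$, and write $\overline n=\mathbf S^n\mathbf 0$. Fix an effective bijective Gödel numbering $\sigma\mapsto\ulcorner\sigma\urcorner\in\mathbb N$ of the sentences (effective: the sentence, as a string of symbols, can be computed from its number). For a theory $T$ of classical first-order logic (with equality) in this signature put $$T_P=\{\ulcorner\sigma\urcorner : T\vdash\sigma\},\qquad T_R=\{\ulcorner\sigma\urcorner : T\vdash\neg\sigma\}.$$ $T$ is RE if $T_P$ is RE. A pair $(A,B)$ of subsets of $\mathbb N$ is \emph{separable in $T$ by the formula $\phi(x)$} (with only one free variable $x$) if $T\vdash\phi(\overline n)$ for every $n\in A$ and $T\vdash\neg\phi(\overline n)$ for every $n\in B$. A \emph{Rosser theory}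 is a consistent RE theory $T$ such that every disjoint pair of RE sets is separable in $T$ by some formula. Theorem. Let $T$ be a Rosser theory and let $(A,B)$ be any EI pair of RE sets. Suppose that $(A,B)$ is separable in $T$ by the formula $\phi(x)$, and define $f:\mathbb N\to\mathbb N$ by $f(n)=\ulcorner\phi(\overline n)\urcorner$. Then there is a recursive function $g:\mathbb N\to\mathbb N$ such that for every $n\in\mathbb N$: \begin{enumerate} \item $n\in f[A]\Leftrightarrow g(n)\in f[A]\Leftrightarrow g(n)\in T_P$; \item $n\in f[B]\Leftrightarrow g(n)\in f[B]\Leftrightarrow g(n)\in T_R$. \end{enumerate} -/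

import Mathlib

open FirstOrder

namespace EffInsep

/-! ### Recursively enumerable sets and effective inseparability -/

/-- The recursively enumerable set with index `i`: the domain of the `i`-th partial recursive
function. -/
def W (i : ℕ) : Set ℕ :=
  {x | ((Denumerable.ofNat Nat.Partrec.Code i).eval x).Dom}

/-- `A` is a recursively enumerable set of natural numbers. -/
def IsRE (A : Set ℕ) : Prop := REPred fun x => x ∈ A

/-- `(A, B)` is an effectively inseparable (disjoint) pair of RE sets. -/
structure IsEI (A B : Set ℕ) : Prop where
  re_left : IsRE A
  re_right : IsRE B
  disjoint : Disjoint A B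
  effective : ∃ f : ℕ → ℕ → ℕ, Computable₂ f ∧ ∀ i j : ℕ,
    A ⊆ W i → B ⊆ W j → Disjoint (W i) (W j) → f i j ∉ W i ∪ W j

/-! ### Classical first-order provability: natural deduction with equality -/

section Deduction

variable {L : Language}

/-- `φ(t)`, where `φ` has one distinguished variable (besides the free variables `0, 1, 2, …`). -/
def instantiate (φ : L.BoundedFormula ℕ 1) (t : L.Term ℕ) : L.Formula ℕ :=
  Language.BoundedFormula.subst φ.toFormula (Sum.elim Language.Term.var fun _ => t)

/-- Rename every free variable `k` to `k + 1`. -/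
def shift (φ : L.Formula ℕ) : L.Formula ℕ := φ.relabel Nat.succ

/-- `φ(x)`, where `x` is the variable `0` and every other free variable `k` has been renamed
to `k + 1`, so that `x` is fresh. -/
def freshInstance (φ : L.BoundedFormula ℕ 1) : L.Formula ℕ :=
  φ.toFormula.relabel (Sum.elim Nat.succ fun _ => 0)

/-- Natural deduction for classical first-order logic with equality. Negation `∼φ` is `φ ⟹ ⊥`,
and the other connectives and `∃` are the usual classical abbreviations. -/
inductive Derives : Set (L.Formula ℕ) → L.Formula ℕ → Prop
  | assumption {Γ : Set (L.Formula ℕ)} {φ : L.Formula ℕ} : φ ∈ Γ → Derives Γ φ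
  | impIntro {Γ : Set (L.Formula ℕ)} {φ ψ : L.Formula ℕ} :
      Derives (insert φ Γ) ψ → Derives Γ (φ.imp ψ)
  | impElim {Γ : Set (L.Formula ℕ)} {φ ψ : L.Formula ℕ} :
      Derives Γ (φ.imp ψ) → Derives Γ φ → Derives Γ ψ
  | byContradiction {Γ : Set (L.Formula ℕ)} {φ : L.Formula ℕ} :
      Derives (insert φ.not Γ) ⊥ → Derives Γ φ
  | allIntro {Γ : Set (L.Formula ℕ)} {φ : L.BoundedFormula ℕ 1} :
      Derives (shift '' Γ) (freshInstance φ) → Derives Γ φ.all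
  | allElim {Γ : Set (L.Formula ℕ)} {φ : L.BoundedFormula ℕ 1} (t : L.Term ℕ) :
      Derives Γ φ.all → Derives Γ (instantiate φ t)
  | eqRefl {Γ : Set (L.Formula ℕ)} (t : L.Term ℕ) : Derives Γ (t.equal t)
  | eqSubst {Γ : Set (L.Formula ℕ)} {s t : L.Term ℕ} (φ : L.BoundedFormula ℕ 1) :
      Derives Γ (s.equal t) → Derives Γ (instantiate φ s) → Derives Γ (instantiate φ t)

/-- A sentence, seen as a formula that may have free variables (and has none). -/
def sentenceToFormula (σ : L.Sentence) : L.Formula ℕ :=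
  Language.Formula.relabel (Empty.elim : Empty → ℕ) σ

/-- `T ⊢ σ`: the sentence `σ` is provable in the theory with set of axioms `T`. -/
def Provable (T : L.Theory) (σ : L.Sentence) : Prop :=
  Derives (sentenceToFormula '' T) (sentenceToFormula σ)

/-- `T` is consistent: no sentence is both provable and refutable. -/
def Consistent (T : L.Theory) : Prop :=
  ¬ ∃ σ : L.Sentence, Provable T σ ∧ Provable T (Language.Formula.not σ)

end Deduction

/-! ### Gödel numberings and the nuclei of a theory -/

section Arithmetization

variable {L : Language} [Encodable (Σ n, L.Functions n)] [Encodable (Σ n, L.Relations n)]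

/-- The code of the string of symbols that makes up a sentence. -/
def stringCode (σ : L.Sentence) : ℕ :=
  Encodable.encode (Language.BoundedFormula.listEncode σ)

variable (L) in
/-- A bijective Gödel numbering of the sentences of `L`. It is effective: the sentence (as a
string of symbols) can be computed from its number. As distinct numbers belong to distinct
sentences, the number can then be computed from the sentence as well, by search. -/
structure GodelNumbering extends L.Sentence ≃ ℕ where
  effective : Computable fun m : ℕ => stringCode (invFun m)

/-- `T_P`, the set of Gödel numbers of the sentences provable in `T`. -/
def provableSet (γ : GodelNumbering L) (T : L.Theory) : Set ℕ :=
  {m | ∃ σ : L.Sentence, γ.toEquiv σ = m ∧ Provable T σ}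

/-- `T_R`, the set of Gödel numbers of the sentences refutable in `T`. -/
def refutableSet (γ : GodelNumbering L) (T : L.Theory) : Set ℕ :=
  {m | ∃ σ : L.Sentence, γ.toEquiv σ = m ∧ Provable T (Language.Formula.not σ)}

end Arithmetization

/-! ### Numerals, separability, Rosser theories -/

section Rosser

variable {L : Language}

/-- The numeral `S ⋯ S 0` with `n` occurrences of `S`. -/
def numeral (zero : L.Constants) (succ : L.Functions 1) : ℕ → L.Term Empty
  | 0 => zero.term
  | n + 1 => succ.apply₁ (numeral zero succ n)

/-- The sentence `φ(n̄)`, for a formula `φ(x)` with one free variable. -/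
def atNumeral (zero : L.Constants) (succ : L.Functions 1) (φ : L.Formula (Fin 1)) (n : ℕ) :
    L.Sentence :=
  Language.BoundedFormula.subst φ fun _ => numeral zero succ n

/-- `(A, B)` is separable in `T` by the formula `φ(x)`. -/
def SeparatedBy (zero : L.Constants) (succ : L.Functions 1) (T : L.Theory) (A B : Set ℕ)
    (φ : L.Formula (Fin 1)) : Prop :=
  (∀ n ∈ A, Provable T (atNumeral zero succ φ n)) ∧
    ∀ n ∈ B, Provable T (Language.Formula.not (atNumeral zero succ φ n))

variable [Encodable (Σ n, L.Functions n)] [Encodable (Σ n, L.Relations n)]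

/-- `T` is a Rosser theory: a consistent RE theory in which any disjoint pair of RE sets is
separable. A theory is identified with the set of sentences provable in it, so it is RE if the set
of Gödel numbers of its theorems is. -/
structure IsRosser (γ : GodelNumbering L) (zero : L.Constants) (succ : L.Functions 1)
    (T : L.Theory) : Prop where
  consistent : Consistent T
  re : IsRE (provableSet γ T)
  separable : ∀ A B : Set ℕ, IsRE A → IsRE B → Disjoint A B →
    ∃ φ : L.Formula (Fin 1), SeparatedBy zero succ T A B φ

end Rosser

end EffInsep

/-!
The function `g` has the form `f ∘ k`. Let `A'` and `B'` be the sets of `n` such that `φ(n̄)` is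
provable, respectively refutable, in `T`. They are RE, they are disjoint as `T` is consistent, and
they include `A` and `B` as `φ` separates `(A, B)`. The pair `(f[A], f[B])` is RE, and it is
disjoint since `f[A] ⊆ T_P` and `f[B] ⊆ T_R`. All that is required of `k` is that it maps `f[A]`
into `A`, `f[B]` into `B`, and the complement of `f[A] ∪ f[B]` into the complement of `A' ∪ B'`.

Such a `k` exists for every disjoint RE pair `(C, D)` in place of `(f[A], f[B])`
(`IsEI.exists_reduction`). With `h` the function that witnesses the effective inseparability, the
double recursion theorem (`exists_double_fixedPoint`) provides, for every `n`, two RE sets `U` and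
`V` that are defined in terms of the value `p = k n` of `h` at their own indices. As long as `n` has
not been enumerated into `C ∪ D`, the sets `U` and `V` copy the enumerations of `A'` and `B'`. If
`n` never appears, then `U = A'` and `V = B'`, whence `p ∉ A' ∪ B'`. If `n` appears in `C`, the
copying of `A'` and `B'` stops, only `A` and `B` are still enumerated, and `p` is put into `V`
unless it was already copied into `U`. In either case `p ∈ A`, since otherwise `U` and `V` would be
disjoint with `p` in their union (`mem_of_race`). The case of `D` is symmetric.

It remains to see that `f` is computable. The string of symbols of `φ(n̄)` is computable from `n` by
induction on `φ` (`computable_listEncode_subst`), and its Gödel number is then found by search,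
because the numbering is effective and bijective.
-/

namespace EffInsep

open Nat.Partrec (Code)
open Encodable Denumerable

/-! ### Stages of recursively enumerable sets -/

theorem exists_code_of_isRE {A : Set ℕ} (hA : IsRE A) :
    ∃ c : Code, ∀ x, x ∈ A ↔ (c.eval x).Dom := by
  have h : Partrec fun x : ℕ => (Part.assert (x ∈ A) fun _ => Part.some ()).map fun _ => 0 :=
    Partrec.map hA ((Computable.const 0).comp Computable.fst).to₂
  obtain ⟨c, hc⟩ := Code.exists_code.1 (Partrec.nat_iff.1 h)
  refine ⟨c, fun x => ?_⟩
  rw [hc]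
  simp [Part.assert]

/-- An RE set is the union of an increasing sequence of uniformly decidable sets, the first of which
is empty. -/
theorem exists_stages {A : Set ℕ} (hA : IsRE A) :
    ∃ a : ℕ → ℕ → Bool, Computable₂ a ∧ (∀ x, a 0 x = false) ∧
      (∀ s t x, s ≤ t → a s x = true → a t x = true) ∧ ∀ x, x ∈ A ↔ ∃ s, a s x = true := by
  obtain ⟨c, hc⟩ := exists_code_of_isRE hA
  refine ⟨fun s x => (Code.evaln s c x).isSome, ?_, ?_, ?_, ?_⟩
  · exact (Primrec.option_isSome.comp (Code.primrec_evaln.comp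
      ((Primrec.fst.pair (Primrec.const c)).pair Primrec.snd))).to_comp
  · intro x
    simp [Code.evaln]
  · intro s t x hst h
    obtain ⟨y, hy⟩ := Option.isSome_iff_exists.1 h
    exact Option.isSome_iff_exists.2 ⟨y, Code.evaln_mono hst hy⟩
  · intro x
    rw [hc, Part.dom_iff_mem]
    simp only [Code.evaln_complete, Option.isSome_iff_exists]
    exact exists_comm

theorem rfind_some_dom (p : ℕ → Bool) : (Nat.rfind (p : ℕ →. Bool)).Dom ↔ ∃ s, p s = true := by
  rw [Nat.rfind_dom']
  simp

theorem isRE_of_exists {P : ℕ → ℕ → Bool} (hP : Computable₂ P) :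
    IsRE {x | ∃ s, P x s = true} := by
  have h : Partrec fun x => Nat.rfind fun s => Part.some (P x s) :=
    Partrec.rfind (Computable₂.partrec₂ hP)
  exact h.dom_re.of_eq fun x => rfind_some_dom (P x)

theorem IsRE.preimage {A : Set ℕ} (hA : IsRE A) {f : ℕ → ℕ} (hf : Computable f) :
    IsRE (f ⁻¹' A) :=
  Partrec.comp hA hf

theorem IsRE.image {A : Set ℕ} (hA : IsRE A) {f : ℕ → ℕ} (hf : Computable f) :
    IsRE (f '' A) := by
  obtain ⟨a, ha, -, -, hA'⟩ := exists_stages hA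
  have hP : Computable₂ fun (m z : ℕ) => a z.unpair.1 z.unpair.2 && (f z.unpair.2 == m) := by
    have hu : Computable fun q : ℕ × ℕ => q.2.unpair := Computable.unpair.comp Computable.snd
    exact Primrec.and.to_comp.comp
      (ha.comp (Computable.fst.comp hu) (Computable.snd.comp hu))
      (Primrec.beq.to_comp.comp (hf.comp (Computable.snd.comp hu)) Computable.fst)
  convert isRE_of_exists hP using 1
  ext m
  simp only [Set.mem_image, hA', Set.mem_ofPred_eq, Bool.and_eq_true, beq_iff_eq]
  constructor
  · rintro ⟨n, ⟨s, hs⟩, hn⟩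
    exact ⟨Nat.pair s n, by simpa using ⟨hs, hn⟩⟩
  · rintro ⟨z, hz, hm⟩
    exact ⟨_, ⟨_, hz⟩, hm⟩

/-! ### The double recursion theorem -/

/-- Two families of RE sets, uniformly in a parameter `n`, may be defined in terms of their own
indices `i n` and `j n`. One application of Kleene's recursion theorem gives a code for both
families at once, which are told apart by a tag in the input. -/
theorem exists_double_fixedPoint {P Q : ℕ × ℕ × ℕ → ℕ × ℕ → Bool} (hP : Computable₂ P)
    (hQ : Computable₂ Q) :
    ∃ i j : ℕ → ℕ, Computable i ∧ Computable j ∧ ∀ n x,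
      (x ∈ W (i n) ↔ ∃ s, P (i n, j n, n) (x, s) = true) ∧
      (x ∈ W (j n) ↔ ∃ s, Q (i n, j n, n) (x, s) = true) := by
  let I (b : ℕ) (c : Code) (n : ℕ) : ℕ := encode (c.curry (Nat.pair b n))
  have hI (b : ℕ) : Computable₂ (I b) :=
    (Primrec.encode.comp (Code.primrec₂_curry.comp Primrec.fst
      (Primrec₂.natPair.comp (Primrec.const b) Primrec.snd))).to_comp
  let F (c : Code) (z : ℕ) : Part ℕ := Nat.rfind fun s => Part.some
    (bif z.unpair.1.unpair.1 == 0 then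
      P (I 0 c z.unpair.1.unpair.2, I 1 c z.unpair.1.unpair.2, z.unpair.1.unpair.2)
        (z.unpair.2, s)
    else
      Q (I 0 c z.unpair.1.unpair.2, I 1 c z.unpair.1.unpair.2, z.unpair.1.unpair.2)
        (z.unpair.2, s))
  have hF : Partrec₂ F := by
    have hc : Computable fun q : (Code × ℕ) × ℕ => q.1.1 := Computable.fst.comp Computable.fst
    have hu : Computable fun q : (Code × ℕ) × ℕ => q.1.2.unpair :=
      Computable.unpair.comp (Computable.snd.comp Computable.fst)
    have hv : Computable fun q : (Code × ℕ) × ℕ => q.1.2.unpair.1.unpair :=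
      Computable.unpair.comp (Computable.fst.comp hu)
    have hn := Computable.snd.comp hv
    have h1 := ((hI 0).comp hc hn).pair (((hI 1).comp hc hn).pair hn)
    have h2 := (Computable.snd.comp hu).pair (Computable.snd (α := Code × ℕ) (β := ℕ))
    refine Partrec.rfind (p := fun (q : Code × ℕ) s => Part.some _)
      (Computable₂.partrec₂ (Computable.cond ?_ (hP.comp h1 h2) (hQ.comp h1 h2)))
    exact Primrec.beq.to_comp.comp (Computable.fst.comp hv) (Computable.const 0)
  obtain ⟨c, hc⟩ := Code.fixed_point₂ hF
  refine ⟨I 0 c, I 1 c, (hI 0).comp (Computable.const c) Computable.id,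
    (hI 1).comp (Computable.const c) Computable.id, fun n x => ⟨?_, ?_⟩⟩
  all_goals
    simp only [W, I, Set.mem_ofPred_eq, ofNat_encode, Code.eval_curry, hc, F]
    refine (rfind_some_dom _).trans ?_
    simp

/-! ### Reducing a pair of RE sets to an effectively inseparable pair -/

/-- The combinatorial heart of the reduction. Stages `α`, `β` enumerate `A'`, `B'`, and at some
stage an event `c` happens, whereas `d` never does. Up to that stage `U` and `V` copy `A'` and
`B'`; from then on they only copy `A` and `B`, and `p` is put into `V` unless it is in the copy of
`A'` made so far. If `p` lies outside any two disjoint such sets `U` and `V`, then `p ∈ A`. -/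
theorem mem_of_race {A B A' B' U V : Set ℕ} {p : ℕ} {α β : ℕ → ℕ → Prop} {c d : ℕ → Prop}
    (hAA' : A ⊆ A') (hBB' : B ⊆ B') (hdisj : Disjoint A' B')
    (hα : ∀ s t x, s ≤ t → α s x → α t x) (hαA : ∀ s x, α s x → x ∈ A')
    (hβB : ∀ s x, β s x → x ∈ B')
    (hc : ∀ s t, s ≤ t → c s → c t) (hc0 : ¬ c 0) (hcs : ∃ s, c s) (hd : ∀ s, ¬ d s)
    (hU : ∀ x, x ∈ U ↔ x ∈ A ∨ ∃ s, (¬ c s ∧ ¬ d s ∧ α s x) ∨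
      (x = p ∧ ¬ d s ∧ d (s + 1) ∧ ¬ β s x))
    (hV : ∀ x, x ∈ V ↔ x ∈ B ∨ ∃ s, (¬ c s ∧ ¬ d s ∧ β s x) ∨
      (x = p ∧ ¬ c s ∧ c (s + 1) ∧ ¬ α s x))
    (hp : A ⊆ U → B ⊆ V → Disjoint U V → p ∉ U ∪ V) : p ∈ A := by
  have hAU : A ⊆ U := fun x hx => (hU x).2 (Or.inl hx)
  have hBV : B ⊆ V := fun x hx => (hV x).2 (Or.inl hx)
  have hUA' : U ⊆ A' := by
    intro x hx
    rcases (hU x).1 hx with h | ⟨s, ⟨-, -, h⟩ | ⟨-, -, h, -⟩⟩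
    exacts [hAA' h, hαA _ _ h, absurd h (hd _)]
  -- `s` is the last stage before `c` happens
  obtain ⟨s, hs, hs1⟩ : ∃ s, ¬ c s ∧ c (s + 1) := by
    by_contra! h
    obtain ⟨t, ht⟩ := hcs
    exact Nat.rec hc0 h t ht
  have hle : ∀ t, ¬ c t → t ≤ s := fun t ht => by
    by_contra! hlt
    exact ht (hc _ _ hlt hs1)
  by_contra hpA
  by_cases hps : α s p
  · -- `p` was copied too early to be put into `V`, so `U ⊆ A'` and `V ⊆ B'`
    have hVB' : V ⊆ B' := by
      intro x hx
      rcases (hV x).1 hx with h | ⟨t, ⟨-, -, h⟩ | ⟨rfl, ht, ht1, h⟩⟩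
      · exact hBB' h
      · exact hβB _ _ h
      · have hst : s ≤ t := by
          by_contra! hlt
          exact hs (hc _ _ hlt ht1)
        exact absurd (hα _ _ _ hst hps) h
    exact hp hAU hBV (hdisj.mono hUA' hVB') (Or.inl ((hU p).2 (Or.inr ⟨s, Or.inl ⟨hs, hd s, hps⟩⟩)))
  · -- `p` is put into `V`, but it is not in `U`
    have hpU : p ∉ U := by
      intro h
      rcases (hU p).1 h with h | ⟨t, ⟨ht, -, h⟩ | ⟨-, -, h, -⟩⟩
      exacts [hpA h, hps (hα _ _ _ (hle t ht) h), hd _ h]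
    have hUV : Disjoint U V := by
      rw [Set.disjoint_left]
      intro x hxU hxV
      rcases (hV x).1 hxV with h | ⟨t, ⟨-, -, h⟩ | ⟨rfl, -, -, -⟩⟩
      · exact Set.disjoint_left.1 hdisj (hUA' hxU) (hBB' h)
      · exact Set.disjoint_left.1 hdisj (hUA' hxU) (hβB _ _ h)
      · exact hpU hxU
    exact hp hAU hBV hUV (Or.inr ((hV p).2 (Or.inr ⟨s, Or.inr ⟨rfl, hs, hs1, hps⟩⟩)))

/-- If `(A, B)` is effectively inseparable and `A' ⊇ A`, `B' ⊇ B` are disjoint RE sets, then every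
disjoint pair `(C, D)` of RE sets reduces to `(A, B)` by a recursive function that maps the
complement of `C ∪ D` into the complement of the larger set `A' ∪ B'`. -/
theorem IsEI.exists_reduction {A B A' B' C D : Set ℕ} (hAB : IsEI A B) (hA' : IsRE A')
    (hB' : IsRE B') (hC : IsRE C) (hD : IsRE D) (hAA' : A ⊆ A') (hBB' : B ⊆ B')
    (hdisj : Disjoint A' B') (hCD : Disjoint C D) :
    ∃ k : ℕ → ℕ, Computable k ∧ ∀ n, (n ∈ C → k n ∈ A) ∧ (n ∈ D → k n ∈ B) ∧
      (n ∉ C → n ∉ D → k n ∉ A' ∪ B') := by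
  obtain ⟨h, hh, hEI⟩ := hAB.effective
  obtain ⟨a, ha, -, -, ha'⟩ := exists_stages hAB.re_left
  obtain ⟨b, hb, -, -, hb'⟩ := exists_stages hAB.re_right
  obtain ⟨α, hα, -, hαm, hα'⟩ := exists_stages hA'
  obtain ⟨β, hβ, -, hβm, hβ'⟩ := exists_stages hB'
  obtain ⟨c, hc, hc0, hcm, hc'⟩ := exists_stages hC
  obtain ⟨d, hd, hd0, hdm, hd'⟩ := exists_stages hD
  -- the definition of `U` in `mem_of_race`, with `p = h i j`
  let R (a α β c d : ℕ → ℕ → Bool) (q : ℕ × ℕ × ℕ) (r : ℕ × ℕ) : Bool :=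
    a r.2 r.1 || ((!c r.2 q.2.2 && (!d r.2 q.2.2 && α r.2 r.1)) ||
      (r.1 == h q.1 q.2.1 && (!d r.2 q.2.2 && (d (r.2 + 1) q.2.2 && !β r.2 r.1))))
  have hR {a α β c d : ℕ → ℕ → Bool} (ha : Computable₂ a) (hα : Computable₂ α)
      (hβ : Computable₂ β) (hc : Computable₂ c) (hd : Computable₂ d) :
      Computable₂ (R a α β c d) := by
    have hi : Computable fun z : (ℕ × ℕ × ℕ) × ℕ × ℕ => z.1.1 :=
      Computable.fst.comp Computable.fst
    have hj : Computable fun z : (ℕ × ℕ × ℕ) × ℕ × ℕ => z.1.2.1 :=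
      Computable.fst.comp (Computable.snd.comp Computable.fst)
    have hn : Computable fun z : (ℕ × ℕ × ℕ) × ℕ × ℕ => z.1.2.2 :=
      Computable.snd.comp (Computable.snd.comp Computable.fst)
    have hx : Computable fun z : (ℕ × ℕ × ℕ) × ℕ × ℕ => z.2.1 :=
      Computable.fst.comp Computable.snd
    have hs : Computable fun z : (ℕ × ℕ × ℕ) × ℕ × ℕ => z.2.2 :=
      Computable.snd.comp Computable.snd
    have hnot := Primrec.not.to_comp
    have hand := Primrec.and.to_comp
    have hor := Primrec.or.to_comp
    exact hor.comp (ha.comp hs hx) (hor.comp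
      (hand.comp (hnot.comp (hc.comp hs hn)) (hand.comp (hnot.comp (hd.comp hs hn))
        (hα.comp hs hx)))
      (hand.comp (Primrec.beq.to_comp.comp hx (hh.comp hi hj))
        (hand.comp (hnot.comp (hd.comp hs hn))
          (hand.comp (hd.comp (Computable.succ.comp hs) hn) (hnot.comp (hβ.comp hs hx))))))
  obtain ⟨i, j, hi, hj, hW⟩ :=
    exists_double_fixedPoint (hR ha hα hβ hc hd) (hR hb hβ hα hd hc)
  refine ⟨fun n => h (i n) (j n), hh.comp hi hj, fun n => ?_⟩
  have hU : ∀ x, x ∈ W (i n) ↔ x ∈ A ∨ ∃ s,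
      (¬ c s n = true ∧ ¬ d s n = true ∧ α s x = true) ∨
      (x = h (i n) (j n) ∧ ¬ d s n = true ∧ d (s + 1) n = true ∧ ¬ β s x = true) := by
    intro x
    rw [(hW n x).1, ha']
    simp only [R, Bool.or_eq_true, Bool.and_eq_true, Bool.not_eq_true', beq_iff_eq, exists_or,
      Bool.not_eq_true]
  have hV : ∀ x, x ∈ W (j n) ↔ x ∈ B ∨ ∃ s,
      (¬ d s n = true ∧ ¬ c s n = true ∧ β s x = true) ∨
      (x = h (i n) (j n) ∧ ¬ c s n = true ∧ c (s + 1) n = true ∧ ¬ α s x = true) := by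
    intro x
    rw [(hW n x).2, hb']
    simp only [R, Bool.or_eq_true, Bool.and_eq_true, Bool.not_eq_true', beq_iff_eq, exists_or,
      Bool.not_eq_true]
  have hαA : ∀ s x, α s x = true → x ∈ A' := fun s x hs => (hα' x).2 ⟨s, hs⟩
  have hβB : ∀ s x, β s x = true → x ∈ B' := fun s x hs => (hβ' x).2 ⟨s, hs⟩
  refine ⟨fun hn => ?_, fun hn => ?_, fun hnC hnD => ?_⟩
  · have hnD : ∀ s, ¬ d s n = true := fun s hs =>
      Set.disjoint_left.1 hCD hn ((hd' n).2 ⟨s, hs⟩)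
    refine mem_of_race hAA' hBB' hdisj hαm hαA hβB (fun s t => hcm s t n) (by simp [hc0])
      ((hc' n).1 hn) hnD hU (fun x => ?_) (hEI _ _)
    simp only [hV, and_left_comm]
  · have hnC : ∀ s, ¬ c s n = true := fun s hs =>
      Set.disjoint_left.1 hCD ((hc' n).2 ⟨s, hs⟩) hn
    refine mem_of_race (V := W (i n)) hBB' hAA' hdisj.symm hβm hβB hαA (fun s t => hdm s t n) (by simp [hd0])
      ((hd' n).1 hn) hnC hV (fun x => ?_) fun h1 h2 h3 => ?_
    · simp only [hU, and_left_comm]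
    · rw [Set.union_comm]
      exact hEI _ _ h2 h1 h3.symm
  · -- the event never happens, so the sets are `A'` and `B'`
    have hc1 : ∀ s, ¬ c s n = true := fun s hs => hnC ((hc' n).2 ⟨s, hs⟩)
    have hd1 : ∀ s, ¬ d s n = true := fun s hs => hnD ((hd' n).2 ⟨s, hs⟩)
    have hUA : W (i n) = A' := by
      ext x
      simp only [hU, hc1, hd1, Bool.false_eq_true, not_false_eq_true, true_and, false_and,
        and_false, or_false, ← hα']
      exact or_iff_right_of_imp fun hx => hAA' hx
    have hVB : W (j n) = B' := by
      ext x
      simp only [hV, hc1, hd1, Bool.false_eq_true, not_false_eq_true, true_and, false_and,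
        and_false, or_false, ← hβ']
      exact or_iff_right_of_imp fun hx => hBB' hx
    have := hEI (i n) (j n)
    rw [hUA, hVB] at this
    exact this hAA' hBB' hdisj

/-! ### Computability of substitution of numerals -/

section Substitution

variable {L : Language}

/-- The number of a list depends only on the numbers of its entries. So the computability of a
sequence of lists over a type that is merely `Encodable` can be expressed, and proved, in terms of
the lists of numbers of the entries. -/
theorem encode_map_encode {α : Type*} [Encodable α] (l : List α) :
    encode (l.map encode) = encode l := by
  induction l with
  | nil => rfl
  | cons a l ih => rw [List.map_cons, encode_list_cons, encode_list_cons, ih, encode_nat]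

theorem computable_encode_list {α : Type*} [Encodable α] {l : ℕ → List α}
    (h : Computable fun n => (l n).map encode) : Computable fun n => encode (l n) :=
  (Computable.encode.comp h).of_eq fun n => encode_map_encode (l n)

theorem computable_flatMap {ι σ : Type*} [Primcodable σ] (l : List ι) {u : ι → ℕ → List σ}
    (h : ∀ i, Computable (u i)) : Computable fun n => l.flatMap fun i => u i n := by
  induction l with
  | nil => exact Computable.const []
  | cons i l ih => exact Computable.list_append.comp (h i) ih

theorem computable_encode_inl {α β : Type*} [Encodable α] [Encodable β] {u : ℕ → α}
    (h : Computable fun n => encode (u n)) :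
    Computable fun n => encode (Sum.inl (u n) : α ⊕ β) :=
  (Primrec.nat_double.to_comp.comp h).of_eq fun _ => (encode_inl _).symm

theorem computable_listEncode_numeral [Encodable (Σ n, L.Functions n)] {β : Type*} [Encodable β]
    (g : Empty → β) (zero : L.Constants) (succ : L.Functions 1) :
    Computable fun n => ((numeral zero succ n).relabel g).listEncode.map encode := by
  have h : Computable fun n : ℕ => Nat.rec (motive := fun _ => List ℕ)
      [encode (Sum.inr ⟨0, zero⟩ : β ⊕ Σ n, L.Functions n)]
      (fun _ l => encode (Sum.inr ⟨1, succ⟩ : β ⊕ Σ n, L.Functions n) :: l) n :=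
    Computable.nat_rec Computable.id (Computable.const _)
      (Computable.list_cons.comp (Computable.const _)
        (Computable.snd.comp Computable.snd)).to₂
  refine h.of_eq fun m => ?_
  induction m with
  | zero => simp [numeral, Language.Constants.term, Language.Term.listEncode]
  | succ m ih =>
    simp only [ih]
    simp [numeral, Language.Functions.apply₁, Language.Term.listEncode, List.finRange_succ]

theorem computable_listEncode_term_subst [Encodable (Σ n, L.Functions n)] {α β : Type*}
    [Encodable β] {s : ℕ → α → L.Term β}
    (hs : ∀ a, Computable fun n => (s n a).listEncode.map encode) (t : L.Term α) :
    Computable fun n => (t.subst (s n)).listEncode.map encode := by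
  induction t with
  | var a => exact hs a
  | func f ts ih =>
    simp only [Language.Term.subst, Language.Term.listEncode, List.map_cons, List.map_flatMap]
    exact Computable.list_cons.comp (Computable.const _) (computable_flatMap _ ih)

theorem computable_encode_term [Encodable (Σ n, L.Functions n)] {β : Type*}
    [Encodable β] {t : ℕ → L.Term β} (h : Computable fun n => (t n).listEncode.map encode) :
    Computable fun n => encode (t n) :=
  computable_encode_list h

variable [Encodable (Σ n, L.Functions n)] [Encodable (Σ n, L.Relations n)]

theorem computable_listEncode_subst (zero : L.Constants) (succ : L.Functions 1) {k : ℕ}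
    (φ : L.BoundedFormula (Fin 1) k) :
    Computable fun n => (φ.subst fun _ => numeral zero succ n).listEncode.map encode := by
  have hterm {k : ℕ} (t : L.Term (Fin 1 ⊕ Fin k)) : Computable fun n =>
      encode (Sum.inl ⟨k, t.subst (Sum.elim (Language.Term.relabel Sum.inl ∘
        fun _ => numeral zero succ n) (Language.Term.var ∘ Sum.inr))⟩ :
        (Σ k, L.Term (Empty ⊕ Fin k)) ⊕ ((Σ n, L.Relations n) ⊕ ℕ)) := by
    refine computable_encode_inl ?_
    simp only [encode_sigma_val]
    refine Primrec₂.natPair.to_comp.comp (Computable.const _)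
      (computable_encode_term (computable_listEncode_term_subst (fun a => ?_) t))
    rcases a with a | a
    · exact computable_listEncode_numeral _ zero succ
    · exact Computable.const _
  unfold Language.BoundedFormula.subst
  induction φ with
  | falsum => exact Computable.const _
  | equal t₁ t₂ =>
    exact Computable.list_cons.comp (hterm t₁)
      (Computable.list_cons.comp (hterm t₂) (Computable.const []))
  | rel R ts =>
    simp only [Language.BoundedFormula.mapTermRel, Language.BoundedFormula.listEncode,
      List.map_append, List.map_map]
    refine Computable.list_append.comp (Computable.const _) ?_
    refine (computable_flatMap (List.finRange _) (fun i => Computable.list_cons.comp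
      (hterm (ts i)) (Computable.const []))).of_eq fun n => ?_
    exact List.flatMap_pure_eq_map _ _
  | imp φ ψ ihφ ihψ =>
    simp only [Language.BoundedFormula.mapTermRel, Language.BoundedFormula.listEncode,
      List.map_append, List.map_cons]
    exact Computable.list_append.comp (Computable.list_cons.comp (Computable.const _) ihφ) ihψ
  | all φ ih =>
    simp only [Language.BoundedFormula.mapTermRel, Language.BoundedFormula.listEncode,
      List.map_cons]
    exact Computable.list_cons.comp (Computable.const _) ih

theorem stringCode_injective : Function.Injective (stringCode (L := L)) := fun σ τ h => by
  have := Language.BoundedFormula.listEncode_sigma_injective (L := L) (α := Empty)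
    (a₁ := ⟨0, σ⟩) (a₂ := ⟨0, τ⟩) (encode_injective h)
  simpa using this

/-- The Gödel number of a sentence is computable from its string of symbols, by search. -/
theorem GodelNumbering.computable_of_stringCode (γ : GodelNumbering L) {σ : ℕ → L.Sentence}
    (h : Computable fun n => stringCode (σ n)) : Computable fun n => γ.toEquiv (σ n) := by
  have hp : Computable₂ fun n m : ℕ => stringCode (γ.invFun m) == stringCode (σ n) :=
    Primrec.beq.to_comp.comp (γ.effective.comp Computable.snd) (h.comp Computable.fst)
  refine (Partrec.rfind (Computable₂.partrec₂ hp)).of_eq_tot fun n => ?_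
  have hinv : ∀ m, stringCode (γ.invFun m) = stringCode (σ n) ↔ m = γ.toEquiv (σ n) := fun m =>
    stringCode_injective.eq_iff.trans γ.toEquiv.symm_apply_eq
  rw [Nat.mem_rfind]
  refine ⟨?_, fun {m} hm => ?_⟩
  · simp
  · have : stringCode (γ.invFun m) ≠ stringCode (σ n) := fun e => hm.ne ((hinv m).1 e)
    simpa using this

theorem GodelNumbering.computable_atNumeral (γ : GodelNumbering L) (zero : L.Constants)
    (succ : L.Functions 1) (φ : L.Formula (Fin 1)) :
    Computable fun n => γ.toEquiv (atNumeral zero succ φ n) :=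
  γ.computable_of_stringCode (computable_encode_list (computable_listEncode_subst zero succ φ))

theorem mem_provableSet {γ : GodelNumbering L} {T : L.Theory} {σ : L.Sentence} :
    γ.toEquiv σ ∈ provableSet γ T ↔ Provable T σ := by
  simp [provableSet]

theorem mem_refutableSet {γ : GodelNumbering L} {T : L.Theory} {σ : L.Sentence} :
    γ.toEquiv σ ∈ refutableSet γ T ↔ Provable T (Language.Formula.not σ) := by
  simp [refutableSet]

/-- The set of numbers at which a formula is provable is RE, if the theory is. -/
theorem isRE_provable_atNumeral {γ : GodelNumbering L} {T : L.Theory}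
    (hT : IsRE (provableSet γ T)) (zero : L.Constants) (succ : L.Functions 1)
    (φ : L.Formula (Fin 1)) : IsRE {n | Provable T (atNumeral zero succ φ n)} := by
  convert hT.preimage (γ.computable_atNumeral zero succ φ) using 1
  ext n
  exact mem_provableSet.symm

end Substitution

end EffInsep

theorem mainTheorem11 {L : FirstOrder.Language} [Finite L.Symbols]
    [Encodable (Σ n, L.Functions n)] [Encodable (Σ n, L.Relations n)]
    (γ : EffInsep.GodelNumbering L) (zero : L.Constants) (succ : L.Functions 1)
    (T : L.Theory) (hT : EffInsep.IsRosser γ zero succ T)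
    (A B : Set ℕ) (hAB : EffInsep.IsEI A B)
    (φ : L.Formula (Fin 1)) (hφ : EffInsep.SeparatedBy zero succ T A B φ)
    (f : ℕ → ℕ) (hf : ∀ n, f n = γ.toEquiv (EffInsep.atNumeral zero succ φ n)) :
    ∃ g : ℕ → ℕ, Computable g ∧ ∀ n : ℕ,
      ((n ∈ f '' A ↔ g n ∈ f '' A) ∧ (g n ∈ f '' A ↔ g n ∈ EffInsep.provableSet γ T)) ∧
      ((n ∈ f '' B ↔ g n ∈ f '' B) ∧ (g n ∈ f '' B ↔ g n ∈ EffInsep.refutableSet γ T)) := by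
  set A' : Set ℕ := {n | EffInsep.Provable T (EffInsep.atNumeral zero succ φ n)} with hA'
  set B' : Set ℕ :=
    {n | EffInsep.Provable T (FirstOrder.Language.Formula.not (EffInsep.atNumeral zero succ φ n))}
    with hB'
  have hfc : Computable f := (γ.computable_atNumeral zero succ φ).of_eq fun n => (hf n).symm
  have hfP : ∀ n, f n ∈ EffInsep.provableSet γ T ↔ n ∈ A' := fun n => by
    rw [hf]; exact EffInsep.mem_provableSet
  have hfR : ∀ n, f n ∈ EffInsep.refutableSet γ T ↔ n ∈ B' := fun n => by
    rw [hf]; exact EffInsep.mem_refutableSet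
  have hA're : EffInsep.IsRE A' := EffInsep.isRE_provable_atNumeral hT.re zero succ φ
  -- `B'` is also the set of numbers at which the formula `∼φ` is provable
  have hB're : EffInsep.IsRE B' := EffInsep.isRE_provable_atNumeral hT.re zero succ φ.not
  have hAA' : A ⊆ A' := hφ.1
  have hBB' : B ⊆ B' := hφ.2
  have hdisj : Disjoint A' B' :=
    Set.disjoint_left.2 fun n hP hR => hT.consistent ⟨_, hP, hR⟩
  have hfPA : ∀ {m}, m ∈ f '' A → m ∈ EffInsep.provableSet γ T := by
    rintro _ ⟨a, ha, rfl⟩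
    exact (hfP a).2 (hAA' ha)
  have hfRB : ∀ {m}, m ∈ f '' B → m ∈ EffInsep.refutableSet γ T := by
    rintro _ ⟨b, hb, rfl⟩
    exact (hfR b).2 (hBB' hb)
  have hCD : Disjoint (f '' A) (f '' B) := by
    rw [Set.disjoint_left]
    rintro _ ⟨a, ha, rfl⟩ hb
    exact Set.disjoint_left.1 hdisj (hAA' ha) ((hfR a).1 (hfRB hb))
  obtain ⟨k, hk, hkspec⟩ := hAB.exists_reduction hA're hB're (hAB.re_left.image hfc)
    (hAB.re_right.image hfc) hAA' hBB' hdisj hCD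
  have hA : ∀ n, f (k n) ∈ EffInsep.provableSet γ T → n ∈ f '' A := fun n hn => by
    by_contra hC
    by_cases hD : n ∈ f '' B
    · exact Set.disjoint_left.1 hdisj ((hfP _).1 hn) (hBB' ((hkspec n).2.1 hD))
    · exact (hkspec n).2.2 hC hD (Or.inl ((hfP _).1 hn))
  have hB : ∀ n, f (k n) ∈ EffInsep.refutableSet γ T → n ∈ f '' B := fun n hn => by
    by_contra hD
    by_cases hC : n ∈ f '' A
    · exact Set.disjoint_left.1 hdisj (hAA' ((hkspec n).1 hC)) ((hfR _).1 hn)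
    · exact (hkspec n).2.2 hC hD (Or.inr ((hfR _).1 hn))
  have hA2 : ∀ n, n ∈ f '' A → f (k n) ∈ f '' A := fun n hn => ⟨_, (hkspec n).1 hn, rfl⟩
  have hB2 : ∀ n, n ∈ f '' B → f (k n) ∈ f '' B := fun n hn => ⟨_, (hkspec n).2.1 hn, rfl⟩
  exact ⟨fun n => f (k n), hfc.comp hk, fun n =>
    ⟨⟨⟨hA2 n, fun h => hA n (hfPA h)⟩, ⟨hfPA, fun h => hA2 n (hA n h)⟩⟩,
      ⟨⟨hB2 n, fun h => hB n (hfRB h)⟩, ⟨hfRB, fun h => hB2 n (hB n h)⟩⟩⟩⟩
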